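/- Let $K$ be an infinite field, $n\ge 0$, $S=K[x_1,\ldots,x_n]$, and let $I\subseteq S$ be a monomial ideal (an ideal generated by monomials). Let $\overline I$ be its integral closure, i.e. the ideal of all $r\in S$ satisfying an equation $r^m+a_1r^{m-1}+\cdots+a_m=0$ with $m\ge 1$ and $a_i\in I^i$ for $1\le i\le m$. Then $\overline I$ is a monomial ideal. If $I$ has one of the following properties, then $\overline I$ has the same property: 1. *of Borel type*: $I:x_i^\infty=I:\langle x_1,\ldots,x_i\rangle^\infty$ for every $i=1,\ldots,n$, where $I:J^\infty=\bigcup_{k\ge 0}(I:J^k)$; 2. *strongly stable*: for every monomial $u\in I$ and all $i<j\le n$ with $x_j\mid u$, one has $x_i(u/x_j)\in I$; 3. *Borel-fixed*: $\alpha(f)\in I$ for every $f\in I$ and every invertible upper triangular $n\times n$ matrix $\alpha=(\alpha_{ij})$ over $K$, acting on $S$ as the $K$-algebra map $x_j\mapsto\sum_i\alpha_{ij}x_i$; 4. *lexsegment*: whenever $u\in I$ and $v$ are monomials of the same degree and $v>_{lex}u$ (lexicographic order with $x_1>\cdots>x_n$), then $v\in I$; 5. *universal lexsegment*: for every $m\ge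 0$ the ideal generated by $I$ in $K[x_1,\ldots,x_{n+m}]$ is lexsegment. Moreover, if $I$ is universal lexsegment, then $\overline I=I$. -/

import Mathlib

namespace MonomialClosure

section IntegralClosure

variable {R : Type*} [CommRing R]

/-- `r` is integral over the ideal `I`: it satisfies an equation of integral dependence
`r ^ m + a₁ r ^ (m - 1) + ⋯ + aₘ = 0` with `m ≥ 1` and `aᵢ ∈ I ^ i` for `1 ≤ i ≤ m`. -/
def IsIntegralOver (I : Ideal R) (r : R) : Prop :=
  ∃ m : ℕ, 0 < m ∧ ∃ a : ℕ → R, (∀ i ∈ Finset.Icc 1 m, a i ∈ I ^ i) ∧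
    r ^ m + ∑ i ∈ Finset.Icc 1 m, a i * r ^ (m - i) = 0

theorem isIntegralOver_iff_rees (I : Ideal R) (r : R) :
    IsIntegralOver I r ↔
      IsIntegral (reesAlgebra I) (Polynomial.monomial 1 r : Polynomial R) := by
  constructor
  · rintro ⟨m, hm, a, ha, h⟩
    classical
    have hmem : ∀ i ∈ Finset.Icc 1 m, Polynomial.monomial i (a i) ∈ reesAlgebra I :=
      fun i hi => reesAlgebra.monomial_mem.2 (ha i hi)
    let c : ℕ → reesAlgebra I := fun i =>
      if hi : i ∈ Finset.Icc 1 m then ⟨Polynomial.monomial i (a i), hmem i hi⟩ else 0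
    refine ⟨Polynomial.X ^ m +
      ∑ i ∈ Finset.Icc 1 m, Polynomial.C (c i) * Polynomial.X ^ (m - i), ?_, ?_⟩
    · refine Polynomial.monic_X_pow_add (lt_of_le_of_lt (Polynomial.degree_sum_le _ _) ?_)
      rw [Finset.sup_lt_iff (by exact WithBot.bot_lt_coe m)]
      intro i hi
      refine lt_of_le_of_lt (Polynomial.degree_C_mul_X_pow_le _ _) ?_
      have := Finset.mem_Icc.1 hi
      exact_mod_cast (by omega : m - i < m)
    · simp only [Polynomial.eval₂_add, Polynomial.eval₂_X_pow, Polynomial.eval₂_finsetSum,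
        Polynomial.eval₂_mul, Polynomial.eval₂_C, Polynomial.monomial_pow, one_mul]
      have hsum : ∑ i ∈ Finset.Icc 1 m, (algebraMap (reesAlgebra I) (Polynomial R)) (c i) *
          Polynomial.monomial (m - i) (r ^ (m - i)) =
          ∑ i ∈ Finset.Icc 1 m, Polynomial.monomial m (a i * r ^ (m - i)) := by
        refine Finset.sum_congr rfl fun i hi => ?_
        have hc : (algebraMap (reesAlgebra I) (Polynomial R)) (c i) =
            Polynomial.monomial i (a i) := by
          simp only [c, dif_pos hi]; rfl
        have := Finset.mem_Icc.1 hi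
        rw [hc, Polynomial.monomial_mul_monomial, Nat.add_sub_cancel' this.2]
      rw [hsum, ← map_sum, ← map_add, h, map_zero]
  · rintro ⟨p, hp, h⟩
    by_cases hR : Nontrivial R
    swap
    · have := not_nontrivial_iff_subsingleton.1 hR
      exact ⟨1, one_pos, fun _ => 0, fun _ _ => zero_mem _, Subsingleton.elim _ _⟩
    set m := p.natDegree with hm
    have hm0 : 0 < m := by
      rcases Nat.eq_zero_or_pos m with h0 | h0
      · rw [hp.natDegree_eq_zero.1 h0] at h
        simp at h
      · exact h0
    refine ⟨m, hm0, fun i => ((p.coeff (m - i) : reesAlgebra I) : Polynomial R).coeff i,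
      fun i _ => (mem_reesAlgebra_iff I _).1 (p.coeff (m - i)).2 i, ?_⟩
    have h2 := congrArg (fun q : Polynomial R => q.coeff m) h
    rw [Polynomial.eval₂_eq_sum_range] at h2
    simp only [Polynomial.finsetSum_coeff, Polynomial.coeff_zero, ← hm] at h2
    rw [Finset.sum_range_succ] at h2
    have hlead : p.coeff m = 1 := hp
    have hterm : ∀ j ≤ m, ((algebraMap (reesAlgebra I) (Polynomial R)) (p.coeff j) *
        (Polynomial.monomial 1 r) ^ j).coeff m =
        ((p.coeff j : reesAlgebra I) : Polynomial R).coeff (m - j) * r ^ j := by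
      intro j hj
      rw [Polynomial.monomial_pow, one_mul]
      obtain ⟨k, hk⟩ := Nat.exists_eq_add_of_le' hj
      rw [hk, Polynomial.coeff_mul_monomial, Nat.add_sub_cancel]
      rfl
    rw [hterm m le_rfl, hlead] at h2
    simp only [Nat.sub_self, OneMemClass.coe_one, Polynomial.coeff_one_zero, one_mul] at h2
    rw [Finset.sum_congr rfl fun j hj => hterm j (Finset.mem_range.1 hj).le] at h2
    rw [add_comm, ← h2]
    congr 1
    refine Finset.sum_bij' (fun i _ => m - i) (fun j _ => m - j) ?_ ?_ ?_ ?_ ?_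
    · intro i hi; simp only [Finset.mem_Icc, Finset.mem_range] at *; omega
    · intro i hi; simp only [Finset.mem_Icc, Finset.mem_range] at *; omega
    · intro i hi; simp only [Finset.mem_Icc] at *; omega
    · intro i hi; simp only [Finset.mem_range] at *; omega
    · intro i hi
      simp only [Finset.mem_Icc] at hi
      rw [Nat.sub_sub_self hi.2]

/-- The integral closure of an ideal: the set of all elements integral over it. -/
def idealClosure (I : Ideal R) : Ideal R where
  carrier := {r | IsIntegralOver I r}
  zero_mem' := by
    change IsIntegralOver I 0
    rw [isIntegralOver_iff_rees, map_zero]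
    exact isIntegral_zero
  add_mem' := by
    intro r s hr hs
    change IsIntegralOver I (r + s)
    rw [isIntegralOver_iff_rees, map_add]
    exact ((isIntegralOver_iff_rees I r).1 hr).add ((isIntegralOver_iff_rees I s).1 hs)
  smul_mem' := by
    intro s r hr
    change IsIntegralOver I (s * r)
    have h : (Polynomial.monomial 1 (s * r) : Polynomial R) =
        algebraMap (reesAlgebra I) (Polynomial R) (algebraMap R (reesAlgebra I) s) *
          Polynomial.monomial 1 r := by
      rw [← IsScalarTower.algebraMap_apply, Polynomial.algebraMap_eq, Polynomial.C_mul_monomial]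
    rw [isIntegralOver_iff_rees, h]
    exact isIntegral_algebraMap.mul ((isIntegralOver_iff_rees I r).1 hr)

/-- The saturation `I : J^∞ = ⋃ₖ (I : J^k)`. -/
def saturation (I J : Ideal R) : Ideal R :=
  ⨆ k : ℕ, Submodule.colon I ((J ^ k : Ideal R) : Set R)

/-- The colon ideals `I : J^k` increase with `k`, so their supremum is their union. -/
theorem mem_saturation_iff (I J : Ideal R) (f : R) :
    f ∈ saturation I J ↔ ∃ k : ℕ, ∀ g ∈ J ^ k, f * g ∈ I := by
  have hmono : Monotone fun k : ℕ => Submodule.colon I ((J ^ k : Ideal R) : Set R) :=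
    fun k l hkl => Submodule.colon_mono le_rfl (Ideal.pow_le_pow_right hkl)
  rw [saturation, Submodule.mem_iSup_of_directed _ hmono.directed_le]
  simp [Submodule.mem_colon]

end IntegralClosure

section Monomial

/-! The polynomial ring is `S = K[x₁, …, xₙ] = MvPolynomial (Fin n) K`, where `x₁, …, xₙ` are
`X 0, …, X (n - 1)`; the monomial with exponent vector `u` is `monomial u 1`. -/

variable {K : Type*} [Field K] {n : ℕ}

/-- `I` is generated by monomials. -/
def IsMonomial (I : Ideal (MvPolynomial (Fin n) K)) : Prop :=
  ∃ A : Set (Fin n →₀ ℕ), I = Ideal.span ((fun u => MvPolynomial.monomial u (1 : K)) '' A)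

/-- `I` is of Borel type: `I : xᵢ^∞ = I : (x₁, …, xᵢ)^∞` for every `i`. -/
def IsBorelType (I : Ideal (MvPolynomial (Fin n) K)) : Prop :=
  ∀ i : Fin n, saturation I (Ideal.span {MvPolynomial.X i}) =
    saturation I (Ideal.span (MvPolynomial.X '' Set.Iic i))

/-- A monomial ideal `I` is strongly stable: if `u ∈ I` is a monomial divisible by `xⱼ` and
`i < j`, then `xᵢ (u / xⱼ) ∈ I`. Here `u = w xⱼ`, so that `xᵢ (u / xⱼ) = w xᵢ`. -/
def IsStronglyStable (I : Ideal (MvPolynomial (Fin n) K)) : Prop :=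
  ∀ (w : Fin n →₀ ℕ) (i j : Fin n), i < j →
    MvPolynomial.monomial (w + Finsupp.single j 1) (1 : K) ∈ I →
    MvPolynomial.monomial (w + Finsupp.single i 1) (1 : K) ∈ I

/-- The action of a matrix on polynomials by the linear substitution `xⱼ ↦ ∑ᵢ αᵢⱼ xᵢ`. -/
noncomputable def linearSubst (α : Matrix (Fin n) (Fin n) K) :
    MvPolynomial (Fin n) K →ₐ[K] MvPolynomial (Fin n) K :=
  MvPolynomial.aeval fun j => ∑ i, MvPolynomial.C (α i j) * MvPolynomial.X i

/-- `I` is Borel-fixed: stable under all invertible upper triangular matrices. -/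
def IsBorelFixed (I : Ideal (MvPolynomial (Fin n) K)) : Prop :=
  ∀ α : Matrix (Fin n) (Fin n) K, IsUnit α → (∀ i j, j < i → α i j = 0) →
    ∀ f ∈ I, linearSubst α f ∈ I

/-- A monomial ideal `I` is lexsegment: if `u ∈ I` and `v` are monomials of the same degree and
`v` is lexicographically larger than `u` (with `x₁ > ⋯ > xₙ`), then `v ∈ I`. -/
def IsLexsegment (I : Ideal (MvPolynomial (Fin n) K)) : Prop :=
  ∀ u v : Fin n →₀ ℕ, MvPolynomial.monomial u (1 : K) ∈ I → v.degree = u.degree →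
    toLex u < toLex v → MvPolynomial.monomial v (1 : K) ∈ I

/-- A monomial ideal `I` is universal lexsegment: for every `m ≥ 0` the ideal it generates in
`K[x₁, …, xₙ₊ₘ]` is lexsegment. -/
def IsUniversalLexsegment (I : Ideal (MvPolynomial (Fin n) K)) : Prop :=
  ∀ m : ℕ, IsLexsegment
    (I.map (MvPolynomial.rename (Fin.castAdd m) :
      MvPolynomial (Fin n) K →ₐ[K] MvPolynomial (Fin (n + m)) K))

end Monomial

end MonomialClosure

namespace MonomialClosure

open MvPolynomial

/-! ### Integral elements and saturations in commutative rings. -/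

section IntegralElements

variable {R S : Type*} [CommRing R] [CommRing S]

/-! Integrality over a monomial ideal is a condition on exponents: `x^u` is integral over `I` iff
`x^(k u) ∈ I^k` for some `k > 0` (`monomial_mem_idealClosure_iff`). The closure is monomial because
it is stable under the torus and `K` is infinite (`isMonomial_of_torusAct_mem`). Borel-fixedness
passes to the closure because ring maps preserve integrality. The other closure statements are
proved inside `I^k`: strong stability passes to powers; setting `xᵢ = 1` compares powers of
saturations; for lexsegment ideals the exchange property `IsLexsegment.replace_tail_pow` of `I^k`
suffices. A universal lexsegment ideal is closed upwards in lex order regardless of degree, so an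
exponent outside it lies below all of its exponents, and taking multiples keeps it so. -/

theorem IsIntegralOver.map {I : Ideal R} {J : Ideal S} {r : R} (f : R →+* S)
    (hIJ : ∀ x ∈ I, f x ∈ J) (h : IsIntegralOver I r) : IsIntegralOver J (f r) := by
  obtain ⟨m, hm, a, ha, e⟩ := h
  refine ⟨m, hm, fun i => f (a i), fun i hi => ?_, ?_⟩
  · have h1 : I.map f ≤ J := Ideal.map_le_iff_le_comap.2 hIJ
    have h2 := Ideal.mem_map_of_mem f (ha i hi)
    rw [Ideal.map_pow] at h2
    exact Ideal.pow_right_mono h1 i h2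
  · simpa using congrArg f e

theorem isIntegralOver_of_pow_mem {I : Ideal R} {r : R} {k : ℕ} (hk : 0 < k)
    (h : r ^ k ∈ I ^ k) : IsIntegralOver I r := by
  classical
  refine ⟨k, hk, fun i => if i = k then -r ^ k else 0, fun i _ => ?_, ?_⟩
  · dsimp only
    split_ifs with hi
    · subst hi
      exact neg_mem h
    · exact zero_mem _
  · rw [Finset.sum_eq_single_of_mem k (Finset.mem_Icc.2 ⟨hk, le_rfl⟩)]
    · simp
    · intro i _ hi
      simp [hi]

theorem le_idealClosure (I : Ideal R) : I ≤ idealClosure I := fun r hr =>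
  isIntegralOver_of_pow_mem one_pos (by simpa using hr)

theorem saturation_anti (I : Ideal R) {J J' : Ideal R} (h : J ≤ J') :
    saturation I J' ≤ saturation I J := by
  intro f hf
  rw [mem_saturation_iff] at hf ⊢
  obtain ⟨k, hk⟩ := hf
  exact ⟨k, fun g hg => hk g (Ideal.pow_right_mono h k hg)⟩

theorem mem_saturation_span_singleton (I : Ideal R) (x f : R) :
    f ∈ saturation I (Ideal.span {x}) ↔ ∃ k : ℕ, f * x ^ k ∈ I := by
  rw [mem_saturation_iff]
  refine exists_congr fun k => ?_
  rw [Ideal.span_singleton_pow]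
  refine ⟨fun h => h _ (Ideal.mem_span_singleton_self _), fun h g hg => ?_⟩
  obtain ⟨c, rfl⟩ := Ideal.mem_span_singleton'.1 hg
  rw [mul_left_comm]
  exact I.mul_mem_left _ h

/-- In a noetherian ring one power of `J` moves the whole saturation `I : J^∞` into `I`. -/
theorem exists_pow_mul_saturation_le [IsNoetherianRing R] (I J : Ideal R) :
    ∃ N : ℕ, J ^ N * saturation I J ≤ I := by
  let c : ℕ →o Ideal R := ⟨fun k => Submodule.colon I ((J ^ k : Ideal R) : Set R),
    fun k l hkl => Submodule.colon_mono le_rfl (Ideal.pow_le_pow_right hkl)⟩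
  obtain ⟨N, hN⟩ := monotone_stabilizes_iff_noetherian.2 ‹IsNoetherianRing R› c
  refine ⟨N, Ideal.mul_le.2 fun g hg f hf => ?_⟩
  obtain ⟨k, hk⟩ := (mem_saturation_iff I J f).1 hf
  have h1 : f ∈ c (max N k) := by
    refine Submodule.mem_colon.2 fun p hp => ?_
    exact hk p (Ideal.pow_le_pow_right (le_max_right N k) hp)
  rw [← hN _ (le_max_left N k)] at h1
  rw [mul_comm]
  exact Submodule.mem_colon.1 h1 g hg

end IntegralElements

/-! ### Monomial ideals, their products, and monomials in the closure. -/

section MonomialIdeals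

variable {K : Type*} [Field K] {n : ℕ} {I J : Ideal (MvPolynomial (Fin n) K)}

theorem monomial_mem_of_le {u v : Fin n →₀ ℕ} (h : monomial u (1 : K) ∈ I) (huv : u ≤ v) :
    monomial v (1 : K) ∈ I :=
  I.mem_of_dvd (monomial_dvd_monomial.2 ⟨Or.inr huv, one_dvd _⟩) h

theorem mem_of_monomial_mem {f : MvPolynomial (Fin n) K}
    (h : ∀ u ∈ f.support, monomial u (1 : K) ∈ I) : f ∈ I := by
  rw [f.as_sum]
  refine I.sum_mem fun u hu => ?_
  have := I.mul_mem_left (C (f.coeff u)) (h u hu)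
  rwa [C_mul_monomial, mul_one] at this

theorem isMonomial_iff : IsMonomial I ↔
    ∀ f ∈ I, ∀ u ∈ f.support, monomial u (1 : K) ∈ I := by
  constructor
  · rintro ⟨A, rfl⟩ f hf u hu
    obtain ⟨a, ha, hau⟩ := mem_ideal_span_monomial_image.1 hf u hu
    exact monomial_mem_of_le (Ideal.subset_span ⟨a, ha, rfl⟩) hau
  · intro h
    refine ⟨{u | monomial u (1 : K) ∈ I}, le_antisymm (fun f hf => ?_) ?_⟩
    · exact mem_of_monomial_mem fun u hu => Ideal.subset_span ⟨u, h f hf u hu, rfl⟩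
    · rw [Ideal.span_le]
      rintro _ ⟨u, hu, rfl⟩
      exact hu

theorem mul_eq_span (A B : Set (Fin n →₀ ℕ)) :
    Ideal.span ((fun u => monomial u (1 : K)) '' A) *
      Ideal.span ((fun u => monomial u (1 : K)) '' B) =
    Ideal.span ((fun u => monomial u (1 : K)) '' (Set.image2 (· + ·) A B)) := by
  rw [Ideal.span_mul_span']
  congr 1
  ext f
  simp only [Set.mem_mul, Set.mem_image, Set.mem_image2]
  constructor
  · rintro ⟨_, ⟨a, ha, rfl⟩, _, ⟨b, hb, rfl⟩, rfl⟩
    exact ⟨a + b, ⟨a, ha, b, hb, rfl⟩, by rw [monomial_mul, one_mul]⟩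
  · rintro ⟨_, ⟨a, ha, b, hb, rfl⟩, rfl⟩
    exact ⟨_, ⟨a, ha, rfl⟩, _, ⟨b, hb, rfl⟩, by rw [monomial_mul, one_mul]⟩

theorem IsMonomial.mul (hI : IsMonomial I) (hJ : IsMonomial J) : IsMonomial (I * J) := by
  obtain ⟨A, rfl⟩ := hI
  obtain ⟨B, rfl⟩ := hJ
  exact ⟨_, mul_eq_span A B⟩

theorem isMonomial_one : IsMonomial (1 : Ideal (MvPolynomial (Fin n) K)) :=
  isMonomial_iff.2 fun _ _ _ _ => by simp

theorem IsMonomial.pow (hI : IsMonomial I) (k : ℕ) : IsMonomial (I ^ k) := by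
  induction k with
  | zero => simpa using isMonomial_one
  | succ k ih => rw [pow_succ]; exact ih.mul hI

theorem monomial_add_mem_mul {a b : Fin n →₀ ℕ} (ha : monomial a (1 : K) ∈ I)
    (hb : monomial b (1 : K) ∈ J) : monomial (a + b) (1 : K) ∈ I * J := by
  have := Ideal.mul_mem_mul ha hb
  rwa [monomial_mul, one_mul] at this

theorem exists_add_of_monomial_mem_mul (hI : IsMonomial I) (hJ : IsMonomial J)
    {u : Fin n →₀ ℕ} (hu : monomial u (1 : K) ∈ I * J) :
    ∃ a b, a + b = u ∧ monomial a (1 : K) ∈ I ∧ monomial b (1 : K) ∈ J := by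
  obtain ⟨A, rfl⟩ := hI
  obtain ⟨B, rfl⟩ := hJ
  rw [mul_eq_span, mem_ideal_span_monomial_image] at hu
  obtain ⟨_, ⟨a, ha, b, hb, rfl⟩, hle⟩ := hu u (by simp [mem_support_iff])
  obtain ⟨c, rfl⟩ := le_iff_exists_add.1 hle
  refine ⟨a, b + c, (add_assoc _ _ _).symm, Ideal.subset_span ⟨a, ha, rfl⟩, ?_⟩
  exact monomial_mem_of_le (Ideal.subset_span ⟨b, hb, rfl⟩) le_self_add

/-- In an integral equation of degree `m` for `x^u`, the leading term has coefficient `1` at `m •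
u`, so some `aᵢ` must have a nonzero coefficient at `i • u`; as `I^i` is monomial, `x^(i u) ∈ I^i`.
-/
theorem monomial_mem_idealClosure_iff (hI : IsMonomial I) (u : Fin n →₀ ℕ) :
    monomial u (1 : K) ∈ idealClosure I ↔
      ∃ k : ℕ, 0 < k ∧ monomial (k • u) (1 : K) ∈ I ^ k := by
  constructor
  · rintro ⟨m, hm, a, ha, e⟩
    have h1 := congrArg (coeff (m • u)) e
    have h2 : ∀ i ∈ Finset.Icc 1 m,
        coeff (m • u) (a i * monomial u (1 : K) ^ (m - i)) = coeff (i • u) (a i) := by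
      intro i hi
      have h3 : m • u = i • u + (m - i) • u := by
        rw [← add_smul, Nat.add_sub_cancel' (Finset.mem_Icc.1 hi).2]
      rw [monomial_pow, one_pow, h3, coeff_mul_monomial, mul_one]
    rw [coeff_add, coeff_sum, Finset.sum_congr rfl h2, monomial_pow, one_pow, coeff_monomial,
      if_pos rfl, coeff_zero] at h1
    have h4 : ∑ i ∈ Finset.Icc 1 m, coeff (i • u) (a i) ≠ 0 := by
      intro h0
      rw [h0, add_zero] at h1
      exact one_ne_zero h1
    obtain ⟨i, hi, hne⟩ := Finset.exists_ne_zero_of_sum_ne_zero h4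
    exact ⟨i, (Finset.mem_Icc.1 hi).1,
      isMonomial_iff.1 (hI.pow i) _ (ha i hi) _ (mem_support_iff.2 hne)⟩
  · rintro ⟨k, hk, h⟩
    exact isIntegralOver_of_pow_mem hk (by rwa [monomial_pow, one_pow])

end MonomialIdeals

/-! ### Torus action and monomiality of the closure. -/

section Torus

variable {K : Type*} [Field K] {n : ℕ} {I : Ideal (MvPolynomial (Fin n) K)}

/-- The substitution `xᵢ ↦ tᵢ xᵢ`. -/
noncomputable def torusAct (t : Fin n → K) :
    MvPolynomial (Fin n) K →ₐ[K] MvPolynomial (Fin n) K :=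
  aeval fun i => C (t i) * X i

theorem torusAct_monomial (t : Fin n → K) (u : Fin n →₀ ℕ) (c : K) :
    torusAct t (monomial u c) = monomial u (c * u.prod fun i k => t i ^ k) := by
  rw [torusAct, aeval_monomial, algebraMap_eq]
  simp only [mul_pow, Finsupp.prod_mul]
  rw [monomial_eq, C_mul, mul_assoc]
  congr 2
  simp [Finsupp.prod]

theorem IsMonomial.torusAct_mem (hI : IsMonomial I) (t : Fin n → K)
    {f : MvPolynomial (Fin n) K} (hf : f ∈ I) : torusAct t f ∈ I := by
  rw [f.as_sum, map_sum]
  refine I.sum_mem fun u hu => ?_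
  have := I.mul_mem_left (C (coeff u f * u.prod fun i k => t i ^ k)) (isMonomial_iff.1 hI f hf u hu)
  rwa [C_mul_monomial, mul_one, ← torusAct_monomial] at this

/-- Over an infinite field, an ideal stable under the torus is generated by monomials. -/
theorem isMonomial_of_torusAct_mem [Infinite K] (h : ∀ t, ∀ f ∈ I, torusAct t f ∈ I) :
    IsMonomial I := by
  refine isMonomial_iff.2 fun f hf u hu => ?_
  by_contra hmem
  obtain ⟨l, hl, hker⟩ := Submodule.exists_le_ker_of_notMem (K := K)
    (p := I.restrictScalars K) (v := monomial u (1 : K)) hmem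
  -- With `l` vanishing on `I` but not at `x^u`, the value of `P` at `t` is `l (torusAct t f) = 0`.
  -- Over an infinite field this forces `P = 0`, contradicting its coefficient at `u`.
  let P : MvPolynomial (Fin n) K :=
    ∑ w ∈ f.support, monomial w (coeff w f * l (monomial w 1))
  have hP : P = 0 := by
    refine MvPolynomial.funext fun t => ?_
    have h1 : l (torusAct t f) = 0 := hker (h t f hf)
    rw [f.as_sum, map_sum, map_sum] at h1
    rw [map_zero, ← h1, map_sum]
    refine Finset.sum_congr rfl fun w _ => ?_
    rw [torusAct_monomial, eval_monomial]
    have h2 : monomial w (coeff w f * w.prod fun i k => t i ^ k) =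
        (coeff w f * w.prod fun i k => t i ^ k) • monomial w (1 : K) := by
      rw [smul_monomial, smul_eq_mul, mul_one]
    rw [h2, map_smul, smul_eq_mul]
    ring
  have h3 := congrArg (coeff u) hP
  simp only [P, coeff_sum, coeff_monomial, coeff_zero, Finset.sum_ite_eq', if_pos hu] at h3
  exact (mul_ne_zero (mem_support_iff.1 hu) hl) h3

theorem IsMonomial.idealClosure [Infinite K] (hI : IsMonomial I) :
    IsMonomial (idealClosure I) :=
  isMonomial_of_torusAct_mem fun t _ hf =>
    IsIntegralOver.map (torusAct t).toRingHom (fun _ hx => hI.torusAct_mem t hx) hf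

end Torus

/-! ### Borel-fixed, strongly stable and Borel type ideals. -/

section Properties

variable {K : Type*} [Field K] {n : ℕ} {I J : Ideal (MvPolynomial (Fin n) K)}

theorem IsBorelFixed.idealClosure (h : IsBorelFixed I) : IsBorelFixed (idealClosure I) :=
  fun α hα hα' _ hf => IsIntegralOver.map (linearSubst α).toRingHom (h α hα hα') hf

/-- One of the two factors is divisible by `xⱼ`; the exchange is made there. -/
theorem IsStronglyStable.mul (hI : IsMonomial I) (hJ : IsMonomial J)
    (sI : IsStronglyStable I) (sJ : IsStronglyStable J) : IsStronglyStable (I * J) := by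
  intro w i j hij hw
  obtain ⟨a, b, hab, ha, hb⟩ := exists_add_of_monomial_mem_mul hI hJ hw
  have hj : a j + b j = w j + 1 := by
    simpa using DFunLike.congr_fun hab j
  by_cases h0 : a j = 0
  · obtain ⟨b', rfl⟩ := le_iff_exists_add'.1 (Finsupp.single_le_iff.2 (by omega : 1 ≤ b j))
    rw [← add_assoc] at hab
    rw [← add_right_cancel hab, add_assoc]
    exact monomial_add_mem_mul ha (sJ _ i j hij hb)
  · obtain ⟨a', rfl⟩ := le_iff_exists_add'.1 (Finsupp.single_le_iff.2 (by omega : 1 ≤ a j))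
    rw [add_right_comm] at hab
    rw [← add_right_cancel hab, add_right_comm]
    exact monomial_add_mem_mul (sI _ i j hij ha) hb

theorem IsStronglyStable.pow (hI : IsMonomial I) (sI : IsStronglyStable I) (k : ℕ) :
    IsStronglyStable (I ^ k) := by
  induction k with
  | zero => intro _ _ _ _ _; simp
  | succ k ih => rw [pow_succ]; exact ih.mul (hI.pow k) hI sI

theorem IsStronglyStable.add_nsmul_mem (sI : IsStronglyStable I) {i j : Fin n} (hij : i < j)
    (k : ℕ) (w : Fin n →₀ ℕ) (h : monomial (w + k • Finsupp.single j 1) (1 : K) ∈ I) :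
    monomial (w + k • Finsupp.single i 1) (1 : K) ∈ I := by
  induction k generalizing w with
  | zero => simpa using h
  | succ k ih =>
    rw [succ_nsmul, ← add_assoc] at h ⊢
    rw [add_right_comm]
    refine ih _ ?_
    rw [add_right_comm]
    exact sI _ i j hij h

theorem IsStronglyStable.idealClosure (hI : IsMonomial I) (sI : IsStronglyStable I) :
    IsStronglyStable (idealClosure I) := by
  intro w i j hij hw
  obtain ⟨k, hk, h⟩ := (monomial_mem_idealClosure_iff hI _).1 hw
  refine (monomial_mem_idealClosure_iff hI _).2 ⟨k, hk, ?_⟩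
  rw [smul_add] at h ⊢
  exact (sI.pow hI k).add_nsmul_mem hij k _ h

/-- Setting `xᵢ = 1` in a monomial of `I ^ s` gives a monomial of `(I : xᵢ^∞) ^ s`. -/
theorem monomial_erase_mem_saturation_pow (hI : IsMonomial I) (i : Fin n) (s : ℕ)
    (u : Fin n →₀ ℕ) (hu : monomial u (1 : K) ∈ I ^ s) :
    monomial (u.erase i) (1 : K) ∈ saturation I (Ideal.span {X i}) ^ s := by
  induction s generalizing u with
  | zero => simp
  | succ s ih =>
    rw [pow_succ] at hu ⊢
    obtain ⟨a, b, rfl, ha, hb⟩ := exists_add_of_monomial_mem_mul (hI.pow s) hI hu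
    rw [Finsupp.erase_add]
    refine monomial_add_mem_mul (ih a ha) ((mem_saturation_span_singleton _ _ _).2 ⟨b i, ?_⟩)
    rwa [X_pow_eq_monomial, monomial_mul, one_mul, Finsupp.erase_add_single]

theorem IsBorelType.idealClosure [Infinite K] (hI : IsMonomial I) (h : IsBorelType I) :
    IsBorelType (idealClosure I) := by
  intro i
  refine le_antisymm (fun f hf => ?_) (saturation_anti _ (Ideal.span_le.2 ?_))
  swap
  · rintro _ rfl
    exact Ideal.subset_span ⟨i, Set.mem_Iic.2 le_rfl, rfl⟩
  obtain ⟨k, hk⟩ := (mem_saturation_span_singleton _ _ _).1 hf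
  obtain ⟨N, hN⟩ := exists_pow_mul_saturation_le I
    (Ideal.span (X '' Set.Iic i : Set (MvPolynomial (Fin n) K)))
  refine mem_of_monomial_mem fun u hu => ?_
  have h1 : monomial (u + Finsupp.single i k) (1 : K) ∈ MonomialClosure.idealClosure I := by
    refine isMonomial_iff.1 hI.idealClosure _ hk _ ?_
    rw [mem_support_iff, X_pow_eq_monomial, coeff_mul_monomial, mul_one]
    exact mem_support_iff.1 hu
  obtain ⟨s, hs, h2⟩ := (monomial_mem_idealClosure_iff hI _).1 h1
  have h3 := monomial_erase_mem_saturation_pow hI i s _ h2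
  rw [h i] at h3
  -- Erasing `xᵢ` removes the unknown power `k`, and what is left divides `x^(s u)`.
  have h4 := monomial_mem_of_le (v := s • u) h3 (by
    intro j
    by_cases hj : j = i
    · simp [hj]
    · simp [Finsupp.erase_ne hj, Ne.symm hj])
  refine (mem_saturation_iff _ _ _).2 ⟨N, fun g hg => ?_⟩
  -- `N` depends only on `I`, and the `s`-th power of `x^u g` lies in `(J^N (I : J^∞))^s ⊆ I^s`,
  -- where `J = (x₁, …, xᵢ)`.
  refine isIntegralOver_of_pow_mem hs ?_
  refine Ideal.pow_right_mono hN s ?_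
  rw [mul_pow, mul_comm, mul_pow]
  refine Ideal.mul_mem_mul ?_ (Ideal.pow_mem_pow hg s)
  rwa [monomial_pow, one_pow]

end Properties

/-! ### Lexsegment and universal lexsegment ideals. -/

section Lexsegment

variable {K : Type*} [Field K] {n : ℕ}

theorem IsLexsegment.isStronglyStable {I : Ideal (MvPolynomial (Fin n) K)}
    (h : IsLexsegment I) : IsStronglyStable I := by
  intro w i j hij hw
  refine h _ _ hw (by simp) ?_
  refine ⟨i, fun d hd => ?_, ?_⟩
  · simp [hd.ne', (lt_trans hd hij).ne']
  · simp [hij.ne']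

/-- In a strongly stable ideal a power of the last variable may be replaced by any monomial of the
same degree. -/
theorem IsStronglyStable.replace_last {I : Ideal (MvPolynomial (Fin (n + 1)) K)}
    (sI : IsStronglyStable I) (y a : Fin (n + 1) →₀ ℕ)
    (h : monomial (a + Finsupp.single (Fin.last n) y.degree) (1 : K) ∈ I) :
    monomial (a + y) (1 : K) ∈ I := by
  induction hm : y.degree generalizing y a with
  | zero =>
    rw [(Finsupp.degree_eq_zero_iff y).1 hm]
    simpa [hm] using h
  | succ m ih =>
    have hy : y ≠ 0 := by
      rintro rfl
      simp at hm
    obtain ⟨j, hj⟩ := Finsupp.ne_iff.1 hy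
    obtain ⟨z, rfl⟩ := le_iff_exists_add'.1
      (Finsupp.single_le_iff.2 (Nat.one_le_iff_ne_zero.2 hj))
    have hz : z.degree = m := by simpa using hm
    have h1 := ih z (a + Finsupp.single (Fin.last n) 1) (by
      rw [hm] at h
      rw [hz, add_assoc, ← Finsupp.single_add, add_comm 1 m]
      exact h) hz
    rw [add_right_comm] at h1
    rw [← add_assoc]
    rcases (Fin.le_last j).eq_or_lt with rfl | hlt
    · exact h1
    · exact sI _ _ _ hlt h1

/-- Split `x^u` into `k` factors from `I`. Where the part beyond `xᵢ` is nontrivial, one extra `xᵢ`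
makes the factor lex larger, so the rest of that part may become a power of the last variable.
Strong stability of `I^k` then turns the collected power into any monomial of its degree. This costs
at most one `xᵢ` per factor, whence the bound on `y i`. -/
theorem IsLexsegment.replace_tail_pow {I : Ideal (MvPolynomial (Fin (n + 1)) K)}
    (hI : IsMonomial I) (h : IsLexsegment I) (i : Fin (n + 1)) (k : ℕ)
    (u y : Fin (n + 1) →₀ ℕ) (hu : monomial u (1 : K) ∈ I ^ k)
    (hy : y.degree = (u.filter fun j => ¬ j ≤ i).degree)
    (hyi : min k y.degree ≤ y i) :
    monomial (u.filter (· ≤ i) + y) (1 : K) ∈ I ^ k := by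
  induction k generalizing u y with
  | zero => simp
  | succ k ih =>
    have hu' := hu
    rw [pow_succ] at hu'
    obtain ⟨a, b, rfl, ha, hb⟩ := exists_add_of_monomial_mem_mul (hI.pow k) hI hu'
    rw [Finsupp.filter_add, map_add] at hy
    set s := (a.filter fun j => ¬ j ≤ i).degree with hs
    set t := (b.filter fun j => ¬ j ≤ i).degree with ht
    have h1 := ih a (Finsupp.single i (min k s) + Finsupp.single (Fin.last n) (s - min k s)) ha
      (by rw [map_add, Finsupp.degree_single, Finsupp.degree_single]; omega)
      (by rw [map_add, Finsupp.degree_single, Finsupp.degree_single, Finsupp.add_apply,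
        Finsupp.single_eq_same]; omega)
    -- `min 1 t` is `0` exactly when `b` has no part beyond `i`; then `b` is kept unchanged.
    have h2 : monomial (b.filter (· ≤ i) +
        (Finsupp.single i (min 1 t) + Finsupp.single (Fin.last n) (t - min 1 t))) (1 : K) ∈ I := by
      have hbsum := Finsupp.filter_add_filter_not b (· ≤ i)
      rcases Nat.eq_zero_or_pos t with h0 | h0
      · rw [ht, Finsupp.degree_eq_zero_iff] at h0
        rw [h0, add_zero] at hbsum
        have h0' : t = 0 := by rw [ht, h0, map_zero]
        simpa [h0', hbsum] using hb
      · have hdeg := congrArg Finsupp.degree hbsum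
        rw [map_add] at hdeg
        refine h _ _ hb
          (by rw [map_add, map_add, Finsupp.degree_single, Finsupp.degree_single]; omega) ⟨i, fun d hd => ?_, ?_⟩
        · simp [hd.ne', hd.le, (lt_of_lt_of_le hd (Fin.le_last i)).ne']
        · simp [Nat.min_eq_left h0]
    obtain ⟨z, rfl⟩ := le_iff_exists_add.1
      (Finsupp.single_le_iff.2 (by omega : min k s + min 1 t ≤ y i))
    rw [← add_assoc]
    refine (h.isStronglyStable.pow hI (k + 1)).replace_last z _ ?_
    have hz : z.degree = (s - min k s) + (t - min 1 t) := by
      simp at hy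
      omega
    have h3 := monomial_add_mem_mul h1 h2
    rw [pow_succ]
    convert h3 using 2
    rw [hz, Finsupp.single_add, Finsupp.single_add, Finsupp.filter_add]
    ac_rfl

theorem IsLexsegment.idealClosure {I : Ideal (MvPolynomial (Fin n) K)} (hI : IsMonomial I)
    (h : IsLexsegment I) : IsLexsegment (idealClosure I) := by
  rintro u v hu hdeg ⟨i, hlt, hi⟩
  obtain _ | n := n
  · exact i.elim0
  obtain ⟨k, hk, hmem⟩ := (monomial_mem_idealClosure_iff hI _).1 hu
  refine (monomial_mem_idealClosure_iff hI _).2 ⟨k, hk, ?_⟩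
  change u i < v i at hi
  have hle : u.filter (· ≤ i) ≤ v := by
    intro j
    rcases lt_trichotomy j i with hj | hj | hj
    · rw [Finsupp.filter_apply_pos (· ≤ i) u hj.le]
      exact (hlt j hj).le
    · rw [Finsupp.filter_apply_pos (· ≤ i) u hj.le, hj]
      exact hi.le
    · rw [Finsupp.filter_apply_neg (· ≤ i) u hj.not_ge]
      exact Nat.zero_le _
  obtain ⟨z, rfl⟩ := le_iff_exists_add.1 hle
  have hsum := congrArg Finsupp.degree (Finsupp.filter_add_filter_not u (· ≤ i))
  rw [map_add] at hsum hdeg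
  -- The surplus at the first differing index gives `k • z` at least `k` copies of `xᵢ`, one for
  -- each factor of `I^k`.
  have hz : 1 ≤ z i := by
    simp at hi
    omega
  have h1 := h.replace_tail_pow hI i k (k • u) (k • z) hmem
    (by rw [Finsupp.filter_smul, map_nsmul, map_nsmul]; congr 1; omega)
    ((min_le_left _ _).trans (by simpa using Nat.mul_le_mul_left k hz))
  rwa [Finsupp.filter_smul, ← smul_add] at h1

/-- A new last variable equalises the degrees without affecting the lex comparison; setting it to
`1` returns to `I`. -/
theorem IsUniversalLexsegment.mem_of_lt {I : Ideal (MvPolynomial (Fin n) K)}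
    (h : IsUniversalLexsegment I) {b u : Fin n →₀ ℕ} (hb : monomial b (1 : K) ∈ I)
    (hbu : toLex b < toLex u) : monomial u (1 : K) ∈ I := by
  have hinj : Function.Injective (Fin.castAdd 1 : Fin n → Fin (n + 1)) :=
    Fin.castAdd_injective n 1
  -- Padding each monomial with the degree of the other gives equal total degrees.
  have h1 : monomial (b.mapDomain (Fin.castAdd 1) + Finsupp.single (Fin.last n) u.degree) (1 : K) ∈
      I.map (rename (Fin.castAdd 1) : MvPolynomial (Fin n) K →ₐ[K] MvPolynomial (Fin (n + 1)) K) := by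
    have := Ideal.mem_map_of_mem
      (rename (Fin.castAdd 1) : MvPolynomial (Fin n) K →ₐ[K] MvPolynomial (Fin (n + 1)) K) hb
    rw [rename_monomial] at this
    exact monomial_mem_of_le this le_self_add
  obtain ⟨i, hlt, hi⟩ := hbu
  have h2 := h 1 _ (u.mapDomain (Fin.castAdd 1) + Finsupp.single (Fin.last n) b.degree) h1
    (by simp [Finsupp.degree_mapDomain, add_comm]) (by
      refine ⟨Fin.castAdd 1 i, fun d hd => ?_, ?_⟩
      · have hdn : (d : ℕ) < n := lt_trans hd i.2
        obtain ⟨e, rfl⟩ : ∃ e : Fin n, Fin.castAdd 1 e = d := ⟨⟨d, hdn⟩, rfl⟩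
        have he : Fin.last n ≠ Fin.castAdd 1 e := fun h => by
          have := congrArg Fin.val h
          simp at this
          omega
        simpa [Finsupp.mapDomain_apply hinj, Finsupp.single_apply, he] using hlt e hd
      · have he : Fin.last n ≠ Fin.castAdd 1 i := fun h => by
          have := congrArg Fin.val h
          simp at this
          omega
        simpa [Finsupp.mapDomain_apply hinj, Finsupp.single_apply, he] using hi)
  let ψ : MvPolynomial (Fin (n + 1)) K →ₐ[K] MvPolynomial (Fin n) K :=
    aeval (Fin.addCases X fun _ => 1)
  have hψ : ∀ f, ψ (rename (Fin.castAdd 1) f) = f := fun f => by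
    have : (Fin.addCases X fun _ => 1 : Fin (n + 1) → MvPolynomial (Fin n) K) ∘ Fin.castAdd 1 =
        X := by
      ext1 j
      simp
    rw [aeval_rename, this, aeval_X_left_apply]
  have hle : I.map (rename (Fin.castAdd 1) :
      MvPolynomial (Fin n) K →ₐ[K] MvPolynomial (Fin (n + 1)) K) ≤ I.comap ψ := by
    refine Ideal.map_le_iff_le_comap.2 fun f hf => ?_
    change ψ (rename (Fin.castAdd 1) f) ∈ I
    rwa [hψ]
  have h3 : ψ _ ∈ I := hle h2
  have h4 : ψ (monomial (Finsupp.single (Fin.last n) b.degree) 1) = 1 := by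
    have h5 : (Fin.addCases X fun _ => 1 : Fin (n + 1) → MvPolynomial (Fin n) K) (Fin.last n) = 1 :=
      Fin.addCases_right (0 : Fin 1)
    rw [← X_pow_eq_monomial, map_pow, aeval_X]
    exact (congrArg (· ^ _) h5).trans (one_pow _)
  rw [← one_mul (1 : K), ← monomial_mul, map_mul, h4, mul_one, ← rename_monomial, hψ] at h3
  exact h3

/-- Lex order is strictly compatible with addition, so the bound multiplies with the number of
factors. -/
theorem IsMonomial.nsmul_lt_of_mem_pow {I : Ideal (MvPolynomial (Fin n) K)} (hI : IsMonomial I)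
    {u : Fin n →₀ ℕ} (h : ∀ b, monomial b (1 : K) ∈ I → toLex u < toLex b) (k : ℕ)
    (v : Fin n →₀ ℕ) (hv : monomial v (1 : K) ∈ I ^ (k + 1)) :
    toLex ((k + 1) • u) < toLex v := by
  induction k generalizing v with
  | zero => simpa using h v (by simpa using hv)
  | succ k ih =>
    rw [pow_succ] at hv
    obtain ⟨a, b, rfl, ha, hb⟩ := exists_add_of_monomial_mem_mul (hI.pow _) hI hv
    rw [succ_nsmul]
    exact add_lt_add (ih a ha) (h b hb)

theorem IsUniversalLexsegment.idealClosure_eq [Infinite K] {I : Ideal (MvPolynomial (Fin n) K)}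
    (hI : IsMonomial I) (h : IsUniversalLexsegment I) : idealClosure I = I := by
  refine le_antisymm (fun f hf => mem_of_monomial_mem fun u hu => ?_) (le_idealClosure I)
  by_contra hmem
  obtain ⟨k, hk, h1⟩ := (monomial_mem_idealClosure_iff hI _).1
    (isMonomial_iff.1 hI.idealClosure f hf u hu)
  obtain ⟨k, rfl⟩ := Nat.exists_eq_add_of_lt hk
  rw [zero_add] at h1
  refine lt_irrefl _ (hI.nsmul_lt_of_mem_pow (fun b hb => ?_) k _ h1)
  rcases lt_trichotomy (toLex b) (toLex u) with h2 | h2 | h2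
  · exact absurd (h.mem_of_lt hb h2) hmem
  · exact absurd (toLex_inj.1 h2 ▸ hb) hmem
  · exact h2

end Lexsegment

end MonomialClosure

theorem theorem2p1 {K : Type*} [Field K] [Infinite K] (n : ℕ)
    (I : Ideal (MvPolynomial (Fin n) K)) (hI : MonomialClosure.IsMonomial I) :
    MonomialClosure.IsMonomial (MonomialClosure.idealClosure I) ∧
    (MonomialClosure.IsBorelType I →
      MonomialClosure.IsBorelType (MonomialClosure.idealClosure I)) ∧
    (MonomialClosure.IsStronglyStable I →
      MonomialClosure.IsStronglyStable (MonomialClosure.idealClosure I)) ∧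
    (MonomialClosure.IsBorelFixed I →
      MonomialClosure.IsBorelFixed (MonomialClosure.idealClosure I)) ∧
    (MonomialClosure.IsLexsegment I →
      MonomialClosure.IsLexsegment (MonomialClosure.idealClosure I)) ∧
    (MonomialClosure.IsUniversalLexsegment I →
      MonomialClosure.IsUniversalLexsegment (MonomialClosure.idealClosure I) ∧
      MonomialClosure.idealClosure I = I) := by
  refine ⟨hI.idealClosure, fun h => h.idealClosure hI, fun h => h.idealClosure hI,
    fun h => h.idealClosure, fun h => h.idealClosure hI, fun h => ?_⟩
  have e := h.idealClosure_eq hI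
  exact ⟨e.symm ▸ h, e⟩
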